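/- Let $F$ be a field of characteristic different from $2$, let $g\ge 0$ be an integer, and let $\ell>g$ be an integer with $\ell\equiv 1 \pmod 4$. Let $f\in F[x]$ be a separable polynomial of degree $2g+1$, and let $X$ be the smooth projective curve $y^2=f(x)$ of genus $g$, with $\infty_X$ its unique point over $x=\infty$. Put $h(z)=z^{2g+2}f(z^{-1})$; the coordinates $z=x^{-1}$, $w=x^{-(g+1)}y$ identify a neighbourhood of $\infty_X$ in $X$ with the affine curve $w^2=h(z)$, and $\infty_X$ with the point $z=w=0$. There $w$ is a local étale coordinate, so every function regular on this neighbourhood, in particular $z$, has an expansion in the completed local ring $F[[w]]$ at $\infty_X$. For $k\ge 0$ let $D^k_w$ be the $k$-th Hasse derivative on $F[[w]]$, $D^k_w\big(\sum_i a_iw^i\big)=\sum_{i\ge k}\binom ik a_iw^{i-k}$. Trivialize the line bundle $\mathcal O(2\ell\infty_X)$ near $\infty_X$ so that a section given by the function $s$ on $X\setminus\{\infty_X\}$ has local expression $z^\ell s$. Then the sequence $$(1,\,y,\,x,\,xy,\,\dots,\,x^{\ell-g-1},\,x^{\ell-g-1}y;\;x^{\ell-g},\,x^{\ell-g+1},\,\dots,\,x^{\ell})$$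 is a basis of $H^0(X,\mathcal O(2\ell\infty_X))$ over $F$, and its local expression near $\infty_X$ is $$\lambda=(\lambda_0,\dots,\lambda_{2\ell-g})=(z^{\ell},\,z^{\ell-g-1}w,\,z^{\ell-1},\,z^{\ell-g-2}w,\,\dots,\,z^{g+1},\,w;\;z^{g},\,z^{g-1},\,\dots,\,1).$$ Let $w(\lambda)=\det\big(D^k_w\lambda_j\big)_{0\le k,j\le 2\ell-g}\in F[[w]]$ be its Hasse Wronskian at $\infty_X$ (row $k$, column $j$), and let $M(\ell,g)$ be the $(g+1)\times(g+1)$ matrix with entries $M_{ij}=\binom{\ell-g+j}{2j-i}$, $0\le i,j\le g$, where a binomial coefficient with negative lower index is $0$. If $\det M(\ell,g)$ is nonzero in $F$, then the lowest-order term of $w(\lambda)$, as a power series in $w$, is equal to the lowest-order term of $$(-1)^{1+\binom{\ell-g}{2}}\cdot\det M(\ell,g)\cdot\big(D^1_wz\big)^{\binom{g+1}{2}}\big(D^2_wz\big)^{\ell(\ell-g)}.$$ -/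

import Mathlib

open scoped Polynomial PowerSeries

noncomputable section

/-! ## Power series: Hasse derivatives, Wronskians, lowest-order terms -/

/-- The `k`-th Hasse derivative `∑ aᵢ wⁱ ↦ ∑ (i choose k) aᵢ wⁱ⁻ᵏ` on `F⟦w⟧`. -/
def hasseD {F : Type*} [Field F] (k : ℕ) (φ : F⟦X⟧) : F⟦X⟧ :=
  PowerSeries.mk fun n => ((n + k).choose k : F) * PowerSeries.coeff (n + k) φ

/-- The Hasse Wronskian `det (Dᵏ φⱼ)`: row `k` (starting from `0`) holds the `k`-th Hasse
derivatives, column `j` belongs to the `j`-th function. -/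
def hasseWronskian {F : Type*} [Field F] {n : ℕ} (φ : Fin n → F⟦X⟧) : F⟦X⟧ :=
  (Matrix.of fun k j : Fin n => hasseD (k : ℕ) (φ j)).det

/-- The lowest-order term `a wᵐ` of a power series `a wᵐ + (higher order)`, `a ≠ 0`
(and `0` for the zero series). -/
def lowestOrderTerm {F : Type*} [Field F] (φ : F⟦X⟧) : F⟦X⟧ :=
  PowerSeries.monomial φ.order.toNat (PowerSeries.coeff φ.order.toNat φ)

/-- The `(g+1) × (g+1)` matrix with entries `binom (ℓ - g + j) (2j - i)`, for `g ≤ ℓ`; a binomial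
coefficient with negative lower index is `0`. -/
def matrixM (ℓ g : ℕ) : Matrix (Fin (g + 1)) (Fin (g + 1)) ℤ :=
  Matrix.of fun i j =>
    if (i : ℕ) ≤ 2 * (j : ℕ) then ((ℓ - g + (j : ℕ)).choose (2 * (j : ℕ) - (i : ℕ)) : ℤ) else 0

/-! ## The curve -/

/-- A smooth hyperelliptic curve of genus `g` over `F` (of characteristic not `2`) whose double
cover of the line is ramified over `∞`: away from the point `∞_X` over `∞` it is `y² = f(x)` with
`f` separable of degree `2g + 1`. -/
structure HyperellipticCurve (F : Type*) [Field F] (g : ℕ) where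
  /-- the defining polynomial -/
  f : F[X]
  natDegree_f : f.natDegree = 2 * g + 1
  separable_f : f.Separable

/-- The ring `F[t, u] / (u² - p(t))`. -/
abbrev DoubleCoverRing {F : Type*} [Field F] (p : F[X]) : Type _ :=
  AdjoinRoot (Polynomial.X ^ 2 - Polynomial.C p : F[X][X])

/-- The coordinate `t` on `u² = p(t)`. -/
def coordT {F : Type*} [Field F] (p : F[X]) : DoubleCoverRing p :=
  AdjoinRoot.of _ Polynomial.X

/-- The coordinate `u` on `u² = p(t)`. -/
def coordU {F : Type*} [Field F] (p : F[X]) : DoubleCoverRing p :=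
  AdjoinRoot.root _

theorem coordU_sq {F : Type*} [Field F] (p : F[X]) :
    coordU p ^ 2 = Polynomial.aeval (coordT p) p := by
  have h := AdjoinRoot.eval₂_root (Polynomial.X ^ 2 - Polynomial.C p : F[X][X])
  simp only [Polynomial.eval₂_sub, Polynomial.eval₂_pow, Polynomial.eval₂_X,
    Polynomial.eval₂_C, sub_eq_zero] at h
  rw [coordU, h, coordT]
  have h2 := Polynomial.aeval_algHom_apply
    (IsScalarTower.toAlgHom F F[X] (AdjoinRoot (Polynomial.X ^ 2 - Polynomial.C p : F[X][X])))
    Polynomial.X p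
  rw [Polynomial.aeval_X_left_apply] at h2
  exact h2.symm

/-- The map out of `F[t, u] / (u² - p(t))` given by `t ↦ a`, `u ↦ b` where `b² = p(a)`. -/
def doubleCoverLift {F : Type*} [Field F] (p : F[X]) {B : Type*} [CommRing B] [Algebra F B]
    (a b : B) (hab : b ^ 2 = Polynomial.aeval a p) : DoubleCoverRing p →ₐ[F] B :=
  AdjoinRoot.liftAlgHom (Polynomial.X ^ 2 - Polynomial.C p : F[X][X]) (Polynomial.aeval a) b (by
    simp [hab])

namespace HyperellipticCurve

variable {F : Type*} [Field F] {g : ℕ} (X : HyperellipticCurve F g)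

/-- `h(z) = z^(2g+2) f(1/z)`; near `∞_X` the curve is `w² = h(z)`. -/
def h : F[X] := X.f.reflect (2 * g + 2)

/-- The coordinate ring `F[x, y] / (y² - f(x))` of the chart `X ∖ {∞_X}`. -/
abbrev AffineRing : Type _ := DoubleCoverRing X.f

/-- The coordinate ring `F[z, w] / (w² - h(z))` of the chart around `∞_X`, the point
`z = w = 0`. -/
abbrev InftyRing : Type _ := DoubleCoverRing X.h

/-- The coordinate `x` on the affine chart. -/
def x : X.AffineRing := coordT X.f

/-- The coordinate `y` on the affine chart. -/
def y : X.AffineRing := coordU X.f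

/-- The coordinate `z` on the chart around `∞_X`. -/
def z : X.InftyRing := coordT X.h

/-- The coordinate `w` on the chart around `∞_X`. -/
def w : X.InftyRing := coordU X.h

/-- The coordinate ring of the overlap of the two charts, the locus `z ≠ 0` (that is, `x ≠ 0`). -/
abbrev OverlapRing : Type _ := Localization.Away X.z

/-- Restriction of functions from the chart around `∞_X` to the overlap. -/
def resInfty : X.InftyRing →ₐ[F] X.OverlapRing :=
  IsScalarTower.toAlgHom F X.InftyRing X.OverlapRing

/-- The function `1 / z` on the overlap. -/
def zInv : X.OverlapRing := IsLocalization.Away.invSelf X.z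

theorem resInfty_z_mul_zInv : X.resInfty X.z * X.zInv = 1 :=
  IsLocalization.Away.mul_invSelf X.z

theorem gluing_relation :
    (X.resInfty X.w * X.zInv ^ (g + 1)) ^ 2 = Polynomial.aeval X.zInv X.f := by
  let i : Invertible X.zInv := ⟨X.resInfty X.z, X.resInfty_z_mul_zInv,
    by rw [mul_comm]; exact X.resInfty_z_mul_zInv⟩
  have h1 := Polynomial.eval₂_reflect_mul_pow (algebraMap F X.OverlapRing) X.zInv (2 * g + 2) X.f
    (by rw [X.natDegree_f]; omega)
  have h2 : X.resInfty X.w ^ 2 = Polynomial.aeval (X.resInfty X.z) X.h := by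
    rw [← map_pow, w, coordU_sq, Polynomial.aeval_algHom_apply]; rfl
  rw [mul_pow, h2, ← pow_mul, Polynomial.aeval_def, Polynomial.aeval_def, ← h1]
  rw [show (g + 1) * 2 = 2 * g + 2 by ring]
  rfl

/-- Restriction of functions from `X ∖ {∞_X}` to the overlap: `x = 1 / z`, `y = w / z^(g+1)`. -/
def resAffine : X.AffineRing →ₐ[F] X.OverlapRing :=
  doubleCoverLift X.f X.zInv (X.resInfty X.w * X.zInv ^ (g + 1)) X.gluing_relation

/-- The space of global sections `H⁰(X, 𝒪(2ℓ ∞_X))`. The divisor `2 ∞_X` is cut out by `z` near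
`∞_X`, so the line bundle `𝒪(2ℓ ∞_X)` is trivial on both charts, with transition function `z^ℓ`: a
section is given by a function `s` on `X ∖ {∞_X}` and a function `t` on the chart around `∞_X`
with `t = z^ℓ s` on the overlap. The local expression of the section at `∞_X` is `t`. -/
def sections (ℓ : ℕ) : Submodule F (X.AffineRing × X.InftyRing) where
  carrier := {s | X.resInfty s.2 = X.resInfty X.z ^ ℓ * X.resAffine s.1}
  add_mem' {a b} ha hb := by
    simp only [Set.mem_ofPred_eq, Prod.snd_add, Prod.fst_add, map_add] at *
    rw [ha, hb, mul_add]
  zero_mem' := by simp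
  smul_mem' c a ha := by
    simp only [Set.mem_ofPred_eq, Prod.smul_snd, Prod.smul_fst, map_smul] at *
    rw [ha, mul_smul_comm]

/-- The `n`-th term of the sequence
`1, y, x, xy, …, x^(ℓ-g-1), x^(ℓ-g-1) y, x^(ℓ-g), x^(ℓ-g+1), …, x^ℓ`
(`n = 0, …, 2ℓ - g`, for `g < ℓ`) of functions on `X ∖ {∞_X}`. -/
def affineMonomial (ℓ n : ℕ) : X.AffineRing :=
  if n < 2 * (ℓ - g) then
    if Even n then X.x ^ (n / 2) else X.x ^ (n / 2) * X.y
  else X.x ^ (n - (ℓ - g))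

/-- The `n`-th term of the sequence
`z^ℓ, z^(ℓ-g-1) w, z^(ℓ-1), z^(ℓ-g-2) w, …, z^(g+1), w, z^g, z^(g-1), …, 1`
(`n = 0, …, 2ℓ - g`, for `g < ℓ`) of functions on the chart around `∞_X`. -/
def inftyMonomial (ℓ n : ℕ) : X.InftyRing :=
  if n < 2 * (ℓ - g) then
    if Even n then X.z ^ (ℓ - n / 2) else X.z ^ (ℓ - g - 1 - n / 2) * X.w
  else X.z ^ (ℓ - (n - (ℓ - g)))

/-! ### Expansion at `∞_X` in the étale coordinate `w` -/

theorem h_coeff_zero : X.h.coeff 0 = 0 := by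
  rw [h, Polynomial.coeff_reflect, Polynomial.revAt_le (by omega)]
  exact Polynomial.coeff_eq_zero_of_natDegree_lt (by rw [X.natDegree_f]; omega)

theorem h_coeff_one : X.h.coeff 1 ≠ 0 := by
  rw [h, Polynomial.coeff_reflect, Polynomial.revAt_le (by omega),
    show 2 * g + 2 - 1 = X.f.natDegree by rw [X.natDegree_f]; omega]
  have hf : X.f ≠ 0 := X.separable_f.ne_zero
  simpa using hf

/-- Since `h(0) = 0 ≠ h'(0)`, there is exactly one power series `z = z(w)` without constant term
such that `w² = h(z)`. -/
theorem existsUnique_zSeries :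
    ∃! Z : F⟦X⟧, PowerSeries.constantCoeff Z = 0 ∧
      (PowerSeries.X : F⟦X⟧) ^ 2 = Polynomial.aeval Z X.h := by
  have hh : X.h ≠ 0 := fun h0 => X.h_coeff_one (by simp [h0])
  have hder : ∀ Z : F⟦X⟧, PowerSeries.constantCoeff Z = 0 →
      IsUnit (Polynomial.aeval Z (Polynomial.derivative X.h)) := by
    intro Z hZ
    rw [PowerSeries.isUnit_iff_constantCoeff]
    have : PowerSeries.constantCoeff (Polynomial.aeval Z (Polynomial.derivative X.h))
        = X.h.coeff 1 := by
      rw [Polynomial.aeval_def, Polynomial.hom_eval₂, hZ, Polynomial.eval₂_at_zero,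
        Polynomial.coeff_derivative]
      simp
    rw [this]
    exact isUnit_iff_ne_zero.2 X.h_coeff_one
  have hroot : ∀ Z : F⟦X⟧,
      Polynomial.eval Z (X.h.map (algebraMap F F⟦X⟧) - Polynomial.C (PowerSeries.X ^ 2)) = 0 ↔
        (PowerSeries.X : F⟦X⟧) ^ 2 = Polynomial.aeval Z X.h := by
    intro Z
    rw [Polynomial.eval_sub, Polynomial.eval_C, Polynomial.eval_map, sub_eq_zero, eq_comm]
    rfl
  have hzero : PowerSeries.constantCoeff (Polynomial.aeval (0 : F⟦X⟧) X.h) = 0 := by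
    rw [Polynomial.aeval_def, Polynomial.eval₂_at_zero, X.h_coeff_zero]
    simp
  have hdm : 0 < X.h.natDegree :=
    lt_of_lt_of_le Nat.one_pos (Polynomial.le_natDegree_of_ne_zero X.h_coeff_one)
  refine existsUnique_of_exists_of_unique ?_ ?_
  · let u : F⟦X⟧ := algebraMap F F⟦X⟧ X.h.leadingCoeff⁻¹
    have hlc : X.h.leadingCoeff ≠ 0 := Polynomial.leadingCoeff_ne_zero.2 hh
    have hu : IsUnit u := (isUnit_iff_ne_zero.2 (inv_ne_zero hlc)).map _
    let q : F⟦X⟧[X] :=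
      Polynomial.C u * (X.h.map (algebraMap F F⟦X⟧) - Polynomial.C (PowerSeries.X ^ 2))
    have hq : q.Monic := by
      have hd : (Polynomial.C (PowerSeries.X ^ 2 : F⟦X⟧)).degree
          < (X.h.map (algebraMap F F⟦X⟧)).degree := by
        refine lt_of_le_of_lt Polynomial.degree_C_le ?_
        rw [Polynomial.degree_map_eq_of_injective (algebraMap F F⟦X⟧).injective]
        exact Polynomial.natDegree_pos_iff_degree_pos.1 hdm
      have hl : (X.h.map (algebraMap F F⟦X⟧) - Polynomial.C (PowerSeries.X ^ 2)).leadingCoeff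
          = algebraMap F F⟦X⟧ X.h.leadingCoeff := by
        rw [Polynomial.leadingCoeff_sub_of_degree_lt hd,
          Polynomial.leadingCoeff_map_of_injective (algebraMap F F⟦X⟧).injective]
      change q.leadingCoeff = 1
      rw [Polynomial.leadingCoeff_mul, Polynomial.leadingCoeff_C, hl, ← map_mul,
        inv_mul_cancel₀ hlc, map_one]
    have hX : ∀ a : F⟦X⟧, a ∈ Ideal.span {(PowerSeries.X : F⟦X⟧)} ↔
        PowerSeries.constantCoeff a = 0 := fun a => by
      rw [Ideal.mem_span_singleton, PowerSeries.X_dvd_iff]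
    obtain ⟨Z, hZ, hZ0⟩ := HenselianRing.is_henselian
      (I := Ideal.span {(PowerSeries.X : F⟦X⟧)}) q hq 0
      (by
        rw [hX, Polynomial.eval_mul, map_mul, Polynomial.eval_sub, Polynomial.eval_map,
          map_sub, ← Polynomial.aeval_def, hzero]
        simp)
      (by
        refine IsUnit.map _ ?_
        rw [Polynomial.derivative_C_mul, Polynomial.eval_C_mul, Polynomial.derivative_sub,
          Polynomial.derivative_C, sub_zero, Polynomial.derivative_map, Polynomial.eval_map]
        exact hu.mul (hder 0 (map_zero _)))
    refine ⟨Z, ?_, ?_⟩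
    · simpa using (hX _).1 hZ0
    · rw [Polynomial.IsRoot.def, Polynomial.eval_C_mul] at hZ
      exact (hroot Z).1 ((hu.mul_right_eq_zero).1 hZ)
  · rintro Z₁ Z₂ ⟨h1, h1'⟩ ⟨h2, h2'⟩
    refine IsLocalRing.eq_of_eval_eq_zero_of_not_isUnit_sub ((hroot Z₁).2 h1') ((hroot Z₂).2 h2')
      ?_ ?_
    · rw [PowerSeries.isUnit_iff_constantCoeff, map_sub, h1, h2, sub_zero]
      exact not_isUnit_zero
    · rw [Polynomial.derivative_sub, Polynomial.derivative_C, sub_zero, Polynomial.derivative_map,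
        Polynomial.eval_map]
      exact hder Z₁ h1

/-- The expansion `z = z(w)` of the function `z` at `∞_X` in the étale coordinate `w`. -/
def zSeries : F⟦X⟧ := X.existsUnique_zSeries.choose

theorem zSeries_spec : PowerSeries.constantCoeff X.zSeries = 0 ∧
    (PowerSeries.X : F⟦X⟧) ^ 2 = Polynomial.aeval X.zSeries X.h :=
  X.existsUnique_zSeries.choose_spec.1

/-- The expansion at `∞_X` of functions regular on the chart around `∞_X` as power series in the
étale coordinate `w`, that is, the map to the completed local ring `F⟦w⟧` of `X` at `∞_X`; the
power series variable is `w`. -/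
def expansion : X.InftyRing →ₐ[F] F⟦X⟧ :=
  doubleCoverLift X.h X.zSeries PowerSeries.X X.zSeries_spec.2

end HyperellipticCurve

end

open scoped Polynomial PowerSeries

noncomputable section

/-! ## Determinants of binomial coefficients -/

/-! Near `∞_X` the function `z` vanishes to order exactly two: `z = w² U` with `U(0) = h₁⁻¹ ≠ 0`,
where `h₁` is the linear coefficient of `h`. Hence each section is `w^e U^m` with explicit `e` and
`m`. In the Wronskian of such functions, scaling row `k` by `w^k` and extracting `w^e` from each
column leaves constant terms `binom e k · U(0)^m`. So the leading coefficient is a power of `U(0)`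
times the integer `det (binom e k)`, at order `∑ e - ∑ k = binom (g+1) 2`
(`exists_hasseWronskian_eq`, `sum_sectionOrder`, `sum_zExponent`).

The integer determinant carries the content (`det_choose_sortedExponent`). Put `a = ℓ - g`. Sorting
the exponents gives `0, …, 2a-1, 2a, 2a+2, …, 2a+2g`, and `binom e k` is the coefficient of `t^k` in
`(1+t)^e`. Since `(1+t)² = t(t+2) + 1`, column operations replace these powers by `(t(t+2))^i` and
`t (t(t+2))^i`. The matrix becomes block triangular, with a unitriangular block and a block equal to
`M` up to powers of `2`, in total `2^binom (g+1) 2`. Sorting reverses the even and the odd exponents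
separately, which gives the sign. As `D¹z = w(2U(0) + ⋯)` and `D²z = U(0) + ⋯`, the claimed product
has the same leading term.

For the basis, both chart rings are free over polynomials on `1` and the square root; comparing
coefficients on the overlap bounds the degrees of the two components of a section. -/

theorem sign_revPerm (n : ℕ) :
    Equiv.Perm.sign (Fin.revPerm : Equiv.Perm (Fin n)) = (-1) ^ n.choose 2 := by
  rw [Equiv.Perm.sign_eq_prod_prod_Iio]
  have h : ∀ j : Fin n, (∏ i ∈ Finset.Iio j,
      if (Fin.revPerm i : Fin n) < Fin.revPerm j then (1 : ℤˣ) else -1) = (-1) ^ (j : ℕ) := by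
    intro j
    rw [Finset.prod_congr rfl (g := fun _ => (-1 : ℤˣ)), Finset.prod_const, Fin.card_Iio]
    intro i hi
    rw [Finset.mem_Iio] at hi
    rw [if_neg]
    simpa using hi.le
  rw [Finset.prod_congr rfl fun j _ => h j, Finset.prod_pow_eq_pow_sum,
    Fin.sum_univ_eq_sum_range (fun i => i), Finset.sum_range_id, Nat.choose_two_right]

/-- Changing each column by a combination of the preceding ones does not change the determinant. -/
theorem det_coeff_eq_of_sub_mem_span {n : ℕ} (P Q : Fin n → ℤ[X])
    (h : ∀ j, P j - Q j ∈ Submodule.span ℤ (Q '' Set.Iio j)) :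
    (Matrix.of fun k j : Fin n => (P j).coeff k).det =
      (Matrix.of fun k j : Fin n => (Q j).coeff k).det := by
  have h' : ∀ j, ∃ c : Fin n → ℤ, (∀ i, j ≤ i → c i = 0) ∧ ∑ i, c i • Q i = P j - Q j := by
    intro j
    obtain ⟨l, hl, hl'⟩ := (Finsupp.mem_span_image_iff_linearCombination ℤ).1 (h j)
    refine ⟨l, fun i hi => ?_, ?_⟩
    · by_contra hne
      exact absurd ((Finsupp.mem_supported _ _).1 hl (Finsupp.mem_support_iff.2 hne))
        (by simpa using hi)
    · rw [← hl', Finsupp.linearCombination_apply, Finsupp.sum_fintype]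
      simp
  choose c hc hsum using h'
  have hmul : (Matrix.of fun k j : Fin n => (P j).coeff k) =
      (Matrix.of fun k j : Fin n => (Q j).coeff k) * (1 + Matrix.of fun i j => c j i) := by
    ext k j
    have := congrArg (fun p => p.coeff (k : ℕ)) (hsum j)
    simp only [Polynomial.finsetSum_coeff, Polynomial.coeff_smul, Polynomial.coeff_sub] at this
    rw [mul_add, mul_one, Matrix.add_apply, Matrix.mul_apply]
    simp only [Matrix.of_apply]
    rw [← sub_eq_iff_eq_add', ← this]
    exact Finset.sum_congr rfl fun i _ => by rw [smul_eq_mul, mul_comm]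
  -- `c j i` vanishes unless `i < j`, so the transition matrix is unitriangular.
  have hdet : (1 + Matrix.of fun i j => c j i).det = 1 := by
    rw [Matrix.det_of_isUpperTriangular]
    · simp [hc]
    · intro i j hij
      have hij' : j < i := hij
      simp [hc j i hij'.le, hij'.ne']
  rw [hmul, Matrix.det_mul, hdet, mul_one]

/-- The exponents `0, 1, …, 2a - 1, 2a, 2a + 2, 2a + 4, …`. -/
def sortedExponent (a j : ℕ) : ℕ := if j < 2 * a then j else 2 * (j - a)

/-- Polynomials adapted to the powers `(1 + t) ^ sortedExponent a j`. -/
def adaptedPoly (a j : ℕ) : ℤ[X] :=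
  if j < 2 * a then
    if Even j then (Polynomial.X * (Polynomial.X + 2)) ^ (j / 2)
    else Polynomial.X * (Polynomial.X * (Polynomial.X + 2)) ^ (j / 2)
  else (Polynomial.X * (Polynomial.X + 2)) ^ (j - a)

theorem one_add_X_sq_pow (m : ℕ) : (1 + Polynomial.X : ℤ[X]) ^ (2 * m) =
    ∑ i ∈ Finset.range m, (m.choose i : ℤ) • (Polynomial.X * (Polynomial.X + 2) : ℤ[X]) ^ i +
      (Polynomial.X * (Polynomial.X + 2)) ^ m := by
  rw [pow_mul, show (1 + Polynomial.X : ℤ[X]) ^ 2 = Polynomial.X * (Polynomial.X + 2) + 1 by ring,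
    add_pow, Finset.sum_range_succ]
  simp [mul_comm]

/-- An even power of `1 + t` involves only powers of `t(t+2)`, never the odd family. This is why the
absence of odd exponents beyond `2a` does no harm. -/
theorem one_add_X_pow_sub_mem_span (a : ℕ) {n : ℕ} (j : Fin n) :
    (1 + Polynomial.X : ℤ[X]) ^ sortedExponent a j - adaptedPoly a j ∈
      Submodule.span ℤ ((fun i : Fin n => adaptedPoly a i) '' Set.Iio j) := by
  have key : ∀ (k : ℕ) (q : ℤ[X]), k < j → adaptedPoly a k = q → q ∈
      Submodule.span ℤ ((fun i : Fin n => adaptedPoly a i) '' Set.Iio j) := fun k q hk hq =>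
    Submodule.subset_span ⟨⟨k, hk.trans j.2⟩, hk, hq⟩
  by_cases hj : (j : ℕ) < 2 * a
  · rcases Nat.even_or_odd' (j : ℕ) with ⟨m, hm | hm⟩
    · have : adaptedPoly a j = (Polynomial.X * (Polynomial.X + 2)) ^ m := by
        rw [adaptedPoly, if_pos hj, if_pos (by rw [hm]; simp), hm, Nat.mul_div_cancel_left _ two_pos]
      rw [this, sortedExponent, if_pos hj, hm, one_add_X_sq_pow, add_sub_cancel_right]
      refine Submodule.sum_mem _ fun i hi => Submodule.smul_mem _ _ (key (2 * i) _ ?_ ?_)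
      · rw [Finset.mem_range] at hi; omega
      · rw [Finset.mem_range] at hi
        rw [adaptedPoly, if_pos (by omega), if_pos (by simp), Nat.mul_div_cancel_left _ two_pos]
    · have h1 : adaptedPoly a j = Polynomial.X * (Polynomial.X * (Polynomial.X + 2)) ^ m := by
        rw [adaptedPoly, if_pos hj, if_neg (by rw [hm]; simp), hm]
        congr 2; omega
      -- Expand `(1+t)^(2m+1) = (1+t)^(2m) + t (1+t)^(2m)`; the top term of the second summand is
      -- the adapted polynomial itself.
      have h2 : (1 + Polynomial.X : ℤ[X]) ^ sortedExponent a j - adaptedPoly a j =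
          ∑ i ∈ Finset.range m,
            (m.choose i : ℤ) • (Polynomial.X * (Polynomial.X + 2) : ℤ[X]) ^ i +
          (Polynomial.X * (Polynomial.X + 2)) ^ m +
          ∑ i ∈ Finset.range m,
            (m.choose i : ℤ) • (Polynomial.X * (Polynomial.X * (Polynomial.X + 2)) ^ i : ℤ[X]) := by
        rw [h1, sortedExponent, if_pos hj, hm, pow_succ, one_add_X_sq_pow]
        simp_rw [← mul_smul_comm]
        rw [← Finset.mul_sum]
        ring
      have heven : ∀ i ≤ m, (Polynomial.X * (Polynomial.X + 2) : ℤ[X]) ^ i ∈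
          Submodule.span ℤ ((fun i : Fin n => adaptedPoly a i) '' Set.Iio j) := fun i hi =>
        key (2 * i) _ (by omega) (by
          rw [adaptedPoly, if_pos (by omega), if_pos (by simp), Nat.mul_div_cancel_left _ two_pos])
      rw [h2]
      refine Submodule.add_mem _ (Submodule.add_mem _
        (Submodule.sum_mem _ fun i hi => Submodule.smul_mem _ _ (heven i ?_)) (heven m le_rfl))
        (Submodule.sum_mem _ fun i hi => Submodule.smul_mem _ _ (key (2 * i + 1) _ ?_ ?_)) <;>
        rw [Finset.mem_range] at hi
      · exact hi.le
      · omega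
      · rw [adaptedPoly, if_pos (by omega), if_neg (by simp)]
        congr 2; omega
  · have : adaptedPoly a j = (Polynomial.X * (Polynomial.X + 2)) ^ ((j : ℕ) - a) := by
      rw [adaptedPoly, if_neg hj]
    rw [this, sortedExponent, if_neg hj, one_add_X_sq_pow, add_sub_cancel_right]
    refine Submodule.sum_mem _ fun i hi => Submodule.smul_mem _ _ ?_
    rw [Finset.mem_range] at hi
    by_cases hi' : i < a
    · refine key (2 * i) _ (by omega) ?_
      rw [adaptedPoly, if_pos (by omega), if_pos (by simp), Nat.mul_div_cancel_left _ two_pos]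
    · refine key (i + a) _ (by omega) ?_
      rw [adaptedPoly, if_neg (by omega), Nat.add_sub_cancel]

theorem adaptedPoly_monic_natDegree (a j : ℕ) (hj : j < 2 * a) :
    (adaptedPoly a j).Monic ∧ (adaptedPoly a j).natDegree = j := by
  have h0 : (Polynomial.X + 2 : ℤ[X]).Monic := by
    simpa using Polynomial.monic_X_add_C (2 : ℤ)
  have h0' : (Polynomial.X + 2 : ℤ[X]).natDegree = 1 := by
    simpa using Polynomial.natDegree_X_add_C (2 : ℤ)
  have h1 : (Polynomial.X * (Polynomial.X + 2) : ℤ[X]).Monic := Polynomial.monic_X.mul h0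
  have h1' : (Polynomial.X * (Polynomial.X + 2) : ℤ[X]).natDegree = 2 := by
    rw [Polynomial.monic_X.natDegree_mul h0, h0', Polynomial.natDegree_X]
  rw [adaptedPoly, if_pos hj]
  split_ifs with he
  · refine ⟨h1.pow _, ?_⟩
    rw [h1.natDegree_pow, h1']
    exact Nat.div_mul_cancel he.two_dvd
  · refine ⟨Polynomial.monic_X.mul (h1.pow _), ?_⟩
    rw [Polynomial.monic_X.natDegree_mul (h1.pow _), h1.natDegree_pow, h1', Polynomial.natDegree_X]
    rw [Nat.not_even_iff_odd] at he
    have := Nat.odd_iff.1 he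
    omega

/-- The polynomial is `t^(a+j) (t+2)^(a+j)`, so the coefficient is that of `t^(a+i-j)` in
`(t+2)^(a+j)`; symmetry of binomials turns the lower index into `2j - i`. -/
theorem coeff_adaptedPoly (a i j : ℕ) :
    (adaptedPoly a (2 * a + j)).coeff (2 * a + i) =
      if i ≤ 2 * j then 2 ^ (2 * j - i) * ((a + j).choose (2 * j - i) : ℤ) else 0 := by
  rw [adaptedPoly, if_neg (by omega), show 2 * a + j - a = a + j by omega, mul_pow,
    Polynomial.coeff_X_pow_mul']
  have h2 : (Polynomial.X + 2 : ℤ[X]) = Polynomial.X + Polynomial.C 2 := by simp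
  by_cases h : a + j ≤ 2 * a + i
  · rw [if_pos h, h2, Polynomial.coeff_X_add_C_pow]
    split_ifs with h'
    · rw [show a + j - (2 * a + i - (a + j)) = 2 * j - i by omega,
        ← Nat.choose_symm (show 2 * j - i ≤ a + j by omega)]
      congr 3; omega
    · rw [Nat.choose_eq_zero_of_lt (by omega)]; simp
  -- Here `j > a + i`, hence `2j - i > a + j` and the binomial coefficient vanishes too.
  · rw [if_neg h]
    split_ifs
    · rw [Nat.choose_eq_zero_of_lt (by omega)]; simp
    · rfl

theorem det_choose_sortedExponent (a g : ℕ) :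
    (Matrix.of fun k j : Fin (2 * a + (g + 1)) => ((sortedExponent a j).choose k : ℤ)).det =
      2 ^ (g + 1).choose 2 * (matrixM (a + g) g).det := by
  have h1 : (Matrix.of fun k j : Fin (2 * a + (g + 1)) => ((sortedExponent a j).choose k : ℤ)) =
      Matrix.of fun k j : Fin (2 * a + (g + 1)) =>
        ((1 + Polynomial.X : ℤ[X]) ^ sortedExponent a j).coeff k := by
    ext k j
    simp [Polynomial.coeff_one_add_X_pow]
  rw [h1, det_coeff_eq_of_sub_mem_span _ (fun j => adaptedPoly a j)
    (fun j => one_add_X_pow_sub_mem_span a j),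
    ← Matrix.det_submatrix_equiv_self finSumFinEquiv, ← Matrix.fromBlocks_toBlocks
      (Matrix.submatrix _ _ _)]
  have h21 : ((Matrix.of fun k j : Fin (2 * a + (g + 1)) =>
      (adaptedPoly a j).coeff k).submatrix finSumFinEquiv finSumFinEquiv).toBlocks₂₁ = 0 := by
    ext i j
    simp only [Matrix.toBlocks₂₁, Matrix.of_apply, Matrix.submatrix_apply,
      finSumFinEquiv_apply_left, finSumFinEquiv_apply_right, Fin.val_castAdd, Fin.val_natAdd,
      Matrix.zero_apply]
    apply Polynomial.coeff_eq_zero_of_natDegree_lt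
    rw [(adaptedPoly_monic_natDegree a j j.2).2]
    omega
  have h11 : ((Matrix.of fun k j : Fin (2 * a + (g + 1)) =>
      (adaptedPoly a j).coeff k).submatrix finSumFinEquiv finSumFinEquiv).toBlocks₁₁.det = 1 := by
    rw [Matrix.det_of_isUpperTriangular]
    · refine Finset.prod_eq_one fun j _ => ?_
      have := adaptedPoly_monic_natDegree a j j.2
      have h := this.1.coeff_natDegree
      rw [this.2] at h
      simpa [Matrix.toBlocks₁₁] using h
    · intro i j hij
      have hij' : j < i := hij
      simp only [Matrix.toBlocks₁₁, Matrix.of_apply, Matrix.submatrix_apply,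
        finSumFinEquiv_apply_left, Fin.val_castAdd]
      apply Polynomial.coeff_eq_zero_of_natDegree_lt
      rw [(adaptedPoly_monic_natDegree a j j.2).2]
      exact hij'
  have h22 : ((Matrix.of fun k j : Fin (2 * a + (g + 1)) =>
      (adaptedPoly a j).coeff k).submatrix finSumFinEquiv finSumFinEquiv).toBlocks₂₂ =
      Matrix.of fun i j : Fin (g + 1) =>
        if (i : ℕ) ≤ 2 * (j : ℕ) then
          2 ^ (2 * (j : ℕ) - i) * ((a + j).choose (2 * j - i) : ℤ) else 0 := by
    ext i j
    simp [Matrix.toBlocks₂₂, coeff_adaptedPoly]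
  rw [h21, Matrix.det_fromBlocks_zero₂₁, h11, h22, one_mul]
  have hS : ∑ i : Fin (g + 1), (i : ℕ) = (g + 1).choose 2 := by
    rw [Fin.sum_univ_eq_sum_range (fun i => i), Finset.sum_range_id, Nat.choose_two_right]
  -- Multiplying row `i` by `2^i` turns the factor `2^(2j-i)` into the column factor `2^(2j)`. One
  -- surplus copy of `2^(∑ i)` is cancelled at the end.
  have hr : (2 : ℤ) ^ (g + 1).choose 2 *
      (Matrix.of fun i j : Fin (g + 1) =>
        if (i : ℕ) ≤ 2 * (j : ℕ) then
          2 ^ (2 * (j : ℕ) - i) * ((a + j).choose (2 * j - i) : ℤ) else 0).det =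
      2 ^ (g + 1).choose 2 * (2 ^ (g + 1).choose 2 * (matrixM (a + g) g).det) := by
    have e1 := Matrix.det_mul_column (fun i : Fin (g + 1) => (2 : ℤ) ^ (i : ℕ))
      (Matrix.of fun i j : Fin (g + 1) =>
        if (i : ℕ) ≤ 2 * (j : ℕ) then
          2 ^ (2 * (j : ℕ) - i) * ((a + j).choose (2 * j - i) : ℤ) else 0)
    have e2 := Matrix.det_mul_row (fun i : Fin (g + 1) => (2 : ℤ) ^ (2 * (i : ℕ)))
      (matrixM (a + g) g)
    rw [Finset.prod_pow_eq_pow_sum, hS] at e1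
    rw [Finset.prod_pow_eq_pow_sum, ← Finset.mul_sum, hS, two_mul, pow_add, mul_assoc] at e2
    rw [← e1, ← e2]
    congr 1
    ext i j
    simp only [matrixM, Matrix.of_apply, Nat.add_sub_cancel]
    split_ifs with h
    · rw [← mul_assoc, ← pow_add, Nat.add_sub_cancel' h]
    · simp
  exact mul_left_cancel₀ (by positivity) hr

/-! ### Orders of the sections and the sorting permutation -/

/-- The `w`-adic order of the `n`-th section. -/
def sectionOrder (ℓ g n : ℕ) : ℕ :=
  if n < 2 * (ℓ - g) then
    if Even n then 2 * (ℓ - n / 2) else 2 * (ℓ - g - 1 - n / 2) + 1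
  else 2 * (ℓ - (n - (ℓ - g)))

/-- The indices of even, respectively odd, order. -/
def evenOddIndex (a g : ℕ) : Fin (a + g + 1) ⊕ Fin a → Fin (2 * a + (g + 1)) :=
  Sum.elim (fun m => if h : (m : ℕ) < a then ⟨2 * m, by omega⟩ else ⟨a + m, by omega⟩)
    (fun m => ⟨2 * m + 1, by omega⟩)

theorem evenOddIndex_bijective (a g : ℕ) : Function.Bijective (evenOddIndex a g) := by
  rw [Fintype.bijective_iff_injective_and_card]
  constructor
  · rintro (x | x) (y | y) h <;> simp only [evenOddIndex, Sum.elim_inl, Sum.elim_inr] at h <;>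
      (try split_ifs at h) <;> rw [Fin.mk.injEq] at h <;>
      first
      | omega
      | (congr 1; ext; omega)
  · simp; omega

theorem evenOddIndex_inl (a g : ℕ) (m : Fin (a + g + 1)) :
    (evenOddIndex a g (Sum.inl m) : ℕ) = if (m : ℕ) < a then 2 * (m : ℕ) else a + m := by
  rw [evenOddIndex, Sum.elim_inl]
  split_ifs <;> rfl

theorem evenOddIndex_inr (a g : ℕ) (m : Fin a) :
    (evenOddIndex a g (Sum.inr m) : ℕ) = 2 * m + 1 := rfl

theorem sortedExponent_evenOddIndex_inl (a g : ℕ) (m : Fin (a + g + 1)) :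
    sortedExponent a (evenOddIndex a g (Sum.inl m)) = 2 * m := by
  rw [evenOddIndex_inl]
  unfold sortedExponent
  split_ifs <;> omega

theorem sortedExponent_evenOddIndex_inr (a g : ℕ) (m : Fin a) :
    sortedExponent a (evenOddIndex a g (Sum.inr m)) = 2 * m + 1 := by
  rw [evenOddIndex_inr, sortedExponent, if_pos (by omega)]

theorem sectionOrder_evenOddIndex_inl (a g : ℕ) (m : Fin (a + g + 1)) :
    sectionOrder (a + g) g (evenOddIndex a g (Sum.inl m)) = 2 * (a + g - m) := by
  rw [evenOddIndex_inl]
  unfold sectionOrder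
  by_cases h : (m : ℕ) < a
  · rw [if_pos h, if_pos (by omega), if_pos (by simp), Nat.mul_div_cancel_left _ two_pos]
  · rw [if_neg h, if_neg (by omega)]
    omega

theorem sectionOrder_evenOddIndex_inr (a g : ℕ) (m : Fin a) :
    sectionOrder (a + g) g (evenOddIndex a g (Sum.inr m)) = 2 * (a - 1 - m) + 1 := by
  rw [evenOddIndex_inr, sectionOrder, if_pos (by omega), if_neg (by simp)]
  omega

/-- On the indices of even exponent the section orders run down from `2(a+g)` to `0` while the
sorted exponents run up; likewise on those of odd exponent. So `σ` is a reversal of `a+g+1` points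
together with a reversal of `a` points. -/
theorem exists_perm_sectionOrder (a g : ℕ) : ∃ σ : Equiv.Perm (Fin (2 * a + (g + 1))),
    Equiv.Perm.sign σ = (-1) ^ ((a + g + 1).choose 2 + a.choose 2) ∧
      ∀ i : Fin (2 * a + (g + 1)), sectionOrder (a + g) g i = sortedExponent a (σ i) := by
  let e := Equiv.ofBijective _ (evenOddIndex_bijective a g)
  refine ⟨e.permCongr (Equiv.Perm.sumCongr Fin.revPerm Fin.revPerm), ?_, fun i => ?_⟩
  · rw [Equiv.Perm.sign_permCongr, Equiv.Perm.sign_sumCongr, sign_revPerm, sign_revPerm, pow_add]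
  · obtain ⟨x, rfl⟩ := e.surjective i
    rw [Equiv.permCongr_apply, Equiv.symm_apply_apply]
    rcases x with m | m
    · simp only [Equiv.Perm.sumCongr_apply, Sum.map_inl]
      change sectionOrder (a + g) g (evenOddIndex a g _) =
        sortedExponent a (evenOddIndex a g _)
      rw [sectionOrder_evenOddIndex_inl, sortedExponent_evenOddIndex_inl]
      simp [Fin.val_rev]
    · simp only [Equiv.Perm.sumCongr_apply, Sum.map_inr]
      change sectionOrder (a + g) g (evenOddIndex a g _) =
        sortedExponent a (evenOddIndex a g _)
      rw [sectionOrder_evenOddIndex_inr, sortedExponent_evenOddIndex_inr]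
      simp only [Fin.revPerm_apply, Fin.val_rev]
      omega

theorem det_choose_sectionOrder (ℓ g : ℕ) (hgℓ : g < ℓ) (hℓ : ℓ % 4 = 1) :
    (Matrix.of fun k j : Fin (2 * ℓ - g + 1) => ((sectionOrder ℓ g j).choose k : ℤ)).det =
      (-1) ^ (1 + (ℓ - g).choose 2) * (2 ^ (g + 1).choose 2 * (matrixM ℓ g).det) := by
  obtain ⟨a, rfl⟩ := Nat.exists_eq_add_of_le' hgℓ.le
  have hn : 2 * (a + g) - g + 1 = 2 * a + (g + 1) := by omega
  obtain ⟨σ, hσ, hσ'⟩ := exists_perm_sectionOrder a g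
  rw [hn]
  simp_rw [hσ']
  have h := Matrix.det_permute' σ
    (Matrix.of fun k j : Fin (2 * a + (g + 1)) => ((sortedExponent a j).choose k : ℤ))
  rw [det_choose_sortedExponent, hσ] at h
  refine h.trans ?_
  -- The congruence on `ℓ` enters here: `ℓ = 4k+1` gives `binom (ℓ+1) 2 = (2k+1)(4k+1)`, whence the
  -- `1` in the exponent of the sign.
  have hodd : Odd ((a + g + 1).choose 2) := by
    obtain ⟨k, hk⟩ : ∃ k, a + g = 4 * k + 1 := ⟨(a + g) / 4, by omega⟩
    rw [hk, Nat.choose_two_right, Nat.odd_iff,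
      show (4 * k + 1 + 1) * (4 * k + 1 + 1 - 1) = 2 * ((2 * k + 1) * (4 * k + 1)) by
        rw [Nat.add_sub_cancel]; ring, Nat.mul_div_cancel_left _ two_pos, ← Nat.odd_iff]
    exact Odd.mul ⟨k, rfl⟩ ⟨2 * k, by ring⟩
  rw [pow_add, hodd.neg_one_pow, Nat.add_sub_cancel, pow_add, pow_one]
  simp

/-! ## Leading terms of Wronskians -/

theorem lowestOrderTerm_X_pow_mul {F : Type*} [Field F] (d : ℕ) (φ : F⟦X⟧)
    (hφ : PowerSeries.constantCoeff φ ≠ 0) :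
    lowestOrderTerm (PowerSeries.X ^ d * φ) =
      PowerSeries.monomial d (PowerSeries.constantCoeff φ) := by
  have h0 : PowerSeries.coeff d (PowerSeries.X ^ d * φ) = PowerSeries.constantCoeff φ := by
    simpa using PowerSeries.coeff_X_pow_mul φ d 0
  have hord : (PowerSeries.X ^ d * φ).order = (d : ℕ∞) := by
    rw [PowerSeries.order_eq_nat]
    refine ⟨by rwa [h0], fun i hi => ?_⟩
    rw [PowerSeries.coeff_X_pow_mul', if_neg (by omega)]
  rw [lowestOrderTerm, hord, ENat.toNat_natCast, h0]

/-- The operator `w^k D^k` is diagonal on monomials, so row scaling removes every index shift. -/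
theorem coeff_X_pow_mul_hasseD {F : Type*} [Field F] (k n : ℕ) (φ : F⟦X⟧) :
    PowerSeries.coeff n (PowerSeries.X ^ k * hasseD k φ) =
      (n.choose k : F) * PowerSeries.coeff n φ := by
  rw [PowerSeries.coeff_X_pow_mul']
  split_ifs with h
  · rw [hasseD, PowerSeries.coeff_mk, Nat.sub_add_cancel h]
  · rw [Nat.choose_eq_zero_of_lt (by omega)]; simp

/-- The Hasse derivative `Dᵏ (wᵉ φ)`, multiplied by `wᵏ` and divided by `wᵉ`. -/
def scaledHasseD {F : Type*} [Field F] (e k : ℕ) (φ : F⟦X⟧) : F⟦X⟧ :=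
  PowerSeries.mk fun n => ((n + e).choose k : F) * PowerSeries.coeff n φ

theorem X_pow_mul_hasseD {F : Type*} [Field F] (e k : ℕ) (φ : F⟦X⟧) :
    PowerSeries.X ^ k * hasseD k (PowerSeries.X ^ e * φ) =
      PowerSeries.X ^ e * scaledHasseD e k φ := by
  ext n
  rw [coeff_X_pow_mul_hasseD, PowerSeries.coeff_X_pow_mul', PowerSeries.coeff_X_pow_mul']
  split_ifs with h
  · rw [scaledHasseD, PowerSeries.coeff_mk, Nat.sub_add_cancel h]
  · simp

theorem constantCoeff_scaledHasseD {F : Type*} [Field F] (e k : ℕ) (φ : F⟦X⟧) :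
    PowerSeries.constantCoeff (scaledHasseD e k φ) =
      (e.choose k : F) * PowerSeries.constantCoeff φ := by
  rw [← PowerSeries.coeff_zero_eq_constantCoeff_apply, scaledHasseD, PowerSeries.coeff_mk,
    zero_add, PowerSeries.coeff_zero_eq_constantCoeff_apply]

/-- The Wronskian of `wᵉʲ φⱼ` is `w ^ (∑ eⱼ - ∑ k)` times a power series with constant term
`(∏ φⱼ(0)) det (binom eⱼ k)`. -/
theorem exists_hasseWronskian_eq {F : Type*} [Field F] {n d : ℕ} (e : Fin n → ℕ)
    (φ : Fin n → F⟦X⟧) (hd : ∑ j, e j = ∑ k : Fin n, (k : ℕ) + d) :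
    ∃ Ψ : F⟦X⟧, hasseWronskian (fun j => PowerSeries.X ^ e j * φ j) = PowerSeries.X ^ d * Ψ ∧
      PowerSeries.constantCoeff Ψ = (∏ j, PowerSeries.constantCoeff (φ j)) *
        (((Matrix.of fun k j : Fin n => ((e j).choose k : ℤ)).det : ℤ) : F) := by
  refine ⟨(Matrix.of fun k j : Fin n => scaledHasseD (e j) k (φ j)).det, ?_, ?_⟩
  -- Compute the determinant of `w^k D^k (w^(e j) φ j)` twice, extracting row factors and column
  -- factors, then cancel the power of `w`.
  · have h1 := Matrix.det_mul_column (fun k : Fin n => (PowerSeries.X : F⟦X⟧) ^ (k : ℕ))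
      (Matrix.of fun k j : Fin n => hasseD (k : ℕ) (PowerSeries.X ^ e j * φ j))
    have h2 := Matrix.det_mul_row (fun j : Fin n => (PowerSeries.X : F⟦X⟧) ^ e j)
      (Matrix.of fun k j : Fin n => scaledHasseD (e j) k (φ j))
    simp only [Matrix.of_apply, X_pow_mul_hasseD] at h1 h2
    rw [h2, Finset.prod_pow_eq_pow_sum, Finset.prod_pow_eq_pow_sum, hd, pow_add, mul_assoc] at h1
    exact (mul_left_cancel₀ (pow_ne_zero _ PowerSeries.X_ne_zero) h1).symm
  · have h2 := Matrix.det_mul_row (fun j : Fin n => PowerSeries.constantCoeff (φ j))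
      (Matrix.of fun k j : Fin n => ((e j).choose k : F))
    rw [RingHom.map_det, ← eq_intCast (Int.castRingHom F), RingHom.map_det]
    convert h2 using 2
    · ext k j
      simp [constantCoeff_scaledHasseD, mul_comm]
    · congr 1; ext k j; simp

/-- After sorting, the first `2a` exponents equal their index and the one at index `2a + i` exceeds
it by `i`; the excess `0 + 1 + ⋯ + g` is the order of the Wronskian. -/
theorem sum_sectionOrder (ℓ g : ℕ) (hgℓ : g < ℓ) :
    ∑ j : Fin (2 * ℓ - g + 1), sectionOrder ℓ g j =
      ∑ k : Fin (2 * ℓ - g + 1), (k : ℕ) + (g + 1).choose 2 := by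
  obtain ⟨a, rfl⟩ := Nat.exists_eq_add_of_le' hgℓ.le
  have hn : 2 * (a + g) - g + 1 = 2 * a + (g + 1) := by omega
  obtain ⟨σ, -, hσ'⟩ := exists_perm_sectionOrder a g
  rw [hn, Finset.sum_congr rfl fun j _ => hσ' j,
    Equiv.sum_comp σ fun j => sortedExponent a j, Fin.sum_univ_add,
    Fin.sum_univ_add (fun k : Fin (2 * a + (g + 1)) => (k : ℕ)), add_assoc]
  congr 1
  · exact Finset.sum_congr rfl fun i _ => by simp [sortedExponent]
  · have hS : ∑ i : Fin (g + 1), (i : ℕ) = (g + 1).choose 2 := by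
      rw [Fin.sum_univ_eq_sum_range (fun i => i), Finset.sum_range_id, Nat.choose_two_right]
    rw [← hS, ← Finset.sum_add_distrib]
    refine Finset.sum_congr rfl fun i _ => ?_
    simp only [sortedExponent, Fin.val_natAdd]
    rw [if_neg (by omega)]
    omega

/-! ## The expansion of `z` -/

namespace HyperellipticCurve

variable {F : Type*} [Field F] {g : ℕ} (X : HyperellipticCurve F g)

/-- As `h(0) = 0`, the equation `w² = h(z)` reads `w² = z · (h/t)(z)`, whose second factor is a unit
with constant term `h₁`. -/
theorem exists_zSeries_eq : ∃ U : F⟦X⟧, X.zSeries = PowerSeries.X ^ 2 * U ∧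
    PowerSeries.constantCoeff U = (X.h.coeff 1)⁻¹ := by
  obtain ⟨h0, h1⟩ := X.zSeries_spec
  have h2 : Polynomial.aeval X.zSeries X.h =
      X.zSeries * Polynomial.aeval X.zSeries X.h.divX := by
    conv_lhs => rw [← Polynomial.divX_mul_X_add X.h, X.h_coeff_zero]
    simp [mul_comm]
  have h3 : PowerSeries.constantCoeff (Polynomial.aeval X.zSeries X.h.divX) = X.h.coeff 1 := by
    rw [Polynomial.aeval_def, Polynomial.hom_eval₂, h0, Polynomial.eval₂_at_zero,
      Polynomial.coeff_divX]
    simp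
  refine ⟨(Polynomial.aeval X.zSeries X.h.divX)⁻¹, ?_, ?_⟩
  · rw [h1, h2, mul_assoc, PowerSeries.mul_inv_cancel, mul_one]
    rw [h3]
    exact X.h_coeff_one
  · rw [PowerSeries.constantCoeff_inv, h3]

theorem expansion_z : X.expansion X.z = X.zSeries := by
  simp [expansion, z, coordT, doubleCoverLift]

theorem expansion_w : X.expansion X.w = PowerSeries.X := by
  simp [expansion, w, coordU, doubleCoverLift]

/-- The exponent of `z` in the `n`-th section near `∞_X`. -/
def zExponent (ℓ g n : ℕ) : ℕ :=
  if n < 2 * (ℓ - g) then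
    if Even n then ℓ - n / 2 else ℓ - g - 1 - n / 2
  else ℓ - (n - (ℓ - g))

theorem expansion_inftyMonomial {U : F⟦X⟧} (hU : X.zSeries = PowerSeries.X ^ 2 * U) (ℓ n : ℕ) :
    X.expansion (X.inftyMonomial ℓ n) =
      PowerSeries.X ^ sectionOrder ℓ g n * U ^ zExponent ℓ g n := by
  unfold inftyMonomial sectionOrder zExponent
  split_ifs <;> simp only [map_mul, map_pow, expansion_z, expansion_w, hU] <;> ring

/-- Each order is twice the exponent of `z`, plus one for the `a` sections containing `w`; the sum
therefore follows from `sum_sectionOrder`. -/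
theorem sum_zExponent (ℓ g : ℕ) (hgℓ : g < ℓ) :
    ∑ j : Fin (2 * ℓ - g + 1), zExponent ℓ g j = (g + 1).choose 2 + ℓ * (ℓ - g) := by
  obtain ⟨a, rfl⟩ := Nat.exists_eq_add_of_le' hgℓ.le
  have hn : 2 * (a + g) - g + 1 = 2 * a + (g + 1) := by omega
  have h1 : ∀ j, sectionOrder (a + g) g j =
      2 * zExponent (a + g) g j + if j < 2 * a ∧ ¬ Even j then 1 else 0 := by
    intro j
    unfold sectionOrder zExponent
    split_ifs <;> first | omega | (exfalso; simp_all)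
  have h2 := sum_sectionOrder (a + g) g hgℓ
  simp only [h1] at h2
  rw [Finset.sum_add_distrib, ← Finset.mul_sum] at h2
  have hodd : ∀ b, ∑ j ∈ Finset.range (2 * b), (if ¬ Even j then 1 else 0) = b := by
    intro b
    induction b with
    | zero => simp
    | succ b ih => rw [mul_add, mul_one, Finset.sum_range_succ, Finset.sum_range_succ, ih]; simp
  have h3 : ∑ j : Fin (2 * (a + g) - g + 1), (if (j : ℕ) < 2 * a ∧ ¬ Even (j : ℕ) then 1 else 0)
      = a := by
    rw [hn, Fin.sum_univ_add, Finset.sum_eq_zero (s := (Finset.univ : Finset (Fin (g + 1)))),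
      add_zero]
    · conv_rhs => rw [← hodd a, ← Fin.sum_univ_eq_sum_range (fun j => if ¬ Even j then 1 else 0)]
      exact Finset.sum_congr rfl fun i _ => by simp
    · intro i _
      simp
  have h4 := Finset.sum_range_id_mul_two (2 * (a + g) - g + 1)
  rw [h3, Fin.sum_univ_eq_sum_range (fun i => i)] at h2
  have h5 := Finset.sum_range_id_mul_two (g + 1)
  rw [Finset.sum_range_id, ← Nat.choose_two_right, Nat.add_sub_cancel] at h5
  rw [hn] at h2 h4 ⊢
  rw [show 2 * a + (g + 1) - 1 = 2 * a + g by omega] at h4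
  rw [Nat.add_sub_cancel]
  nlinarith

theorem constantCoeff_hasseD_two_zSeries {U : F⟦X⟧} (hU : X.zSeries = PowerSeries.X ^ 2 * U) :
    PowerSeries.constantCoeff (hasseD 2 X.zSeries) = PowerSeries.constantCoeff U := by
  rw [← PowerSeries.coeff_zero_eq_constantCoeff_apply, hasseD, PowerSeries.coeff_mk, hU,
    PowerSeries.coeff_X_pow_mul']
  simp

/-- The cofactor has constant term `2 U(0)`, which supplies the power of `2` found in the binomial
determinant. -/
theorem hasseD_one_zSeries {U : F⟦X⟧} (hU : X.zSeries = PowerSeries.X ^ 2 * U) :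
    hasseD 1 X.zSeries = PowerSeries.X * scaledHasseD 2 1 U := by
  have h := X_pow_mul_hasseD 2 1 U
  rw [← hU, pow_one, pow_two, mul_assoc] at h
  exact mul_left_cancel₀ PowerSeries.X_ne_zero h

theorem lowestOrderTerm_hasseWronskian (hF : (2 : F) ≠ 0) (ℓ : ℕ) (hgℓ : g < ℓ)
    (hℓ : ℓ % 4 = 1) (hM : ((matrixM ℓ g).det : F) ≠ 0) :
    lowestOrderTerm (hasseWronskian fun i : Fin (2 * ℓ - g + 1) =>
        X.expansion (X.inftyMonomial ℓ i)) =
      lowestOrderTerm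
        ((-1) ^ (1 + (ℓ - g).choose 2) * PowerSeries.C ((matrixM ℓ g).det : F) *
          hasseD 1 (X.expansion X.z) ^ (g + 1).choose 2 *
          hasseD 2 (X.expansion X.z) ^ (ℓ * (ℓ - g))) := by
  obtain ⟨U, hU, hU0⟩ := X.exists_zSeries_eq
  have hc : PowerSeries.constantCoeff U ≠ 0 := by
    rw [hU0]; exact inv_ne_zero X.h_coeff_one
  obtain ⟨Ψ, hΨ, hΨ0⟩ := exists_hasseWronskian_eq
    (fun j : Fin (2 * ℓ - g + 1) => sectionOrder ℓ g j) (fun j => U ^ zExponent ℓ g j)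
    (sum_sectionOrder ℓ g hgℓ)
  simp only [X.expansion_inftyMonomial hU]
  rw [det_choose_sectionOrder ℓ g hgℓ hℓ] at hΨ0
  simp only [map_pow] at hΨ0
  rw [Finset.prod_pow_eq_pow_sum, sum_zExponent ℓ g hgℓ] at hΨ0
  simp only [Int.cast_mul, Int.cast_pow, Int.cast_neg, Int.cast_one, Int.cast_ofNat] at hΨ0
  -- `Φ` is the right-hand product with its factor `w^binom (g+1) 2` removed; it suffices to match
  -- constant terms with `Ψ` and see that they are nonzero.
  set Φ : F⟦X⟧ := (-1) ^ (1 + (ℓ - g).choose 2) * PowerSeries.C ((matrixM ℓ g).det : F) *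
    scaledHasseD 2 1 U ^ (g + 1).choose 2 * hasseD 2 X.zSeries ^ (ℓ * (ℓ - g)) with hΦ
  have hΦ0 : PowerSeries.constantCoeff Φ = PowerSeries.constantCoeff Ψ := by
    rw [hΨ0, hΦ]
    simp only [map_mul, map_pow, map_neg, map_one, PowerSeries.constantCoeff_C,
      constantCoeff_scaledHasseD, X.constantCoeff_hasseD_two_zSeries hU]
    norm_num
    ring
  have hΨne : PowerSeries.constantCoeff Ψ ≠ 0 := by
    rw [hΨ0]
    exact mul_ne_zero (pow_ne_zero _ hc) (mul_ne_zero (pow_ne_zero _ (by simp))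
      (mul_ne_zero (pow_ne_zero _ hF) hM))
  rw [hΨ, lowestOrderTerm_X_pow_mul _ _ hΨne, ← hΦ0,
    ← lowestOrderTerm_X_pow_mul _ _ (hΦ0 ▸ hΨne), expansion_z, X.hasseD_one_zSeries hU, hΦ]
  congr 1
  ring

end HyperellipticCurve

/-! ## Normal forms in the ring of a double cover -/

theorem monic_X_sq_sub_C {F : Type*} [Field F] (p : F[X]) :
    (Polynomial.X ^ 2 - Polynomial.C p : F[X][X]).Monic :=
  Polynomial.monic_X_pow_sub_C p two_ne_zero

theorem aeval_coordT {F : Type*} [Field F] (p a : F[X]) :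
    Polynomial.aeval (coordT p) a =
      AdjoinRoot.of (Polynomial.X ^ 2 - Polynomial.C p : F[X][X]) a := by
  have h := Polynomial.aeval_algHom_apply
    (IsScalarTower.toAlgHom F F[X] (AdjoinRoot (Polynomial.X ^ 2 - Polynomial.C p : F[X][X])))
    Polynomial.X a
  rw [Polynomial.aeval_X_left_apply] at h
  exact h

theorem mk_C_add_C_mul_X {F : Type*} [Field F] (p a b : F[X]) :
    AdjoinRoot.mk (Polynomial.X ^ 2 - Polynomial.C p : F[X][X])
        (Polynomial.C b * Polynomial.X + Polynomial.C a) =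
      Polynomial.aeval (coordT p) a + Polynomial.aeval (coordT p) b * coordU p := by
  rw [aeval_coordT, aeval_coordT, map_add, map_mul, AdjoinRoot.mk_C, AdjoinRoot.mk_C,
    AdjoinRoot.mk_X, add_comm]
  rfl

theorem DoubleCoverRing.exists_eq {F : Type*} [Field F] {p : F[X]} (s : DoubleCoverRing p) :
    ∃ a b : F[X], s = Polynomial.aeval (coordT p) a + Polynomial.aeval (coordT p) b * coordU p := by
  obtain ⟨q, rfl⟩ := AdjoinRoot.mk_surjective s
  have hd : (q %ₘ (Polynomial.X ^ 2 - Polynomial.C p)).natDegree ≤ 1 := by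
    have h := Polynomial.natDegree_modByMonic_lt q (monic_X_sq_sub_C p) (fun h => by
      have := congrArg Polynomial.natDegree h
      rw [Polynomial.natDegree_X_pow_sub_C, Polynomial.natDegree_one] at this
      omega)
    rw [Polynomial.natDegree_X_pow_sub_C] at h
    omega
  obtain ⟨b, a, hab⟩ := Polynomial.exists_eq_X_add_C_of_natDegree_le_one hd
  refine ⟨a, b, ?_⟩
  rw [← mk_C_add_C_mul_X, ← hab, AdjoinRoot.mk_eq_mk]
  exact ⟨q /ₘ (Polynomial.X ^ 2 - Polynomial.C p), by
    linear_combination -(Polynomial.modByMonic_add_div q (Polynomial.X ^ 2 - Polynomial.C p))⟩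

theorem DoubleCoverRing.eq_zero {F : Type*} [Field F] {p : F[X]} {a b : F[X]}
    (h : Polynomial.aeval (coordT p) a + Polynomial.aeval (coordT p) b * coordU p = 0) :
    a = 0 ∧ b = 0 := by
  rw [← mk_C_add_C_mul_X, AdjoinRoot.mk_eq_zero] at h
  have h0 := Polynomial.eq_zero_of_dvd_of_natDegree_lt h (by
    rw [Polynomial.natDegree_X_pow_sub_C]
    exact Nat.lt_succ_of_le Polynomial.natDegree_linear_le)
  have ha := congrArg (fun q => q.coeff 0) h0
  have hb := congrArg (fun q => q.coeff 1) h0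
  simp only [Polynomial.coeff_add, Polynomial.coeff_C_mul, Polynomial.coeff_X_zero,
    Polynomial.coeff_X_one, Polynomial.coeff_C_zero, Polynomial.coeff_C_of_ne_zero one_ne_zero,
    mul_zero, zero_add, mul_one, add_zero, Polynomial.coeff_zero] at ha hb
  exact ⟨ha, hb⟩

theorem DoubleCoverRing.ext_iff {F : Type*} [Field F] {p : F[X]} {a b a' b' : F[X]} :
    Polynomial.aeval (coordT p) a + Polynomial.aeval (coordT p) b * coordU p =
      Polynomial.aeval (coordT p) a' + Polynomial.aeval (coordT p) b' * coordU p ↔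
    a = a' ∧ b = b' := by
  constructor
  · intro h
    have h' := DoubleCoverRing.eq_zero (p := p) (a := a - a') (b := b - b') (by
      rw [map_sub, map_sub]; linear_combination h)
    exact ⟨sub_eq_zero.1 h'.1, sub_eq_zero.1 h'.2⟩
  · rintro ⟨rfl, rfl⟩; rfl

/-! ### Global sections and their basis -/

namespace HyperellipticCurve

variable {F : Type*} [Field F] {g : ℕ} (X : HyperellipticCurve F g)

/-- In the normal form `a + b w`, multiplication by `z` multiplies both polynomials by the variable.
Hence identities on the overlap descend to the chart at `∞_X`. -/
theorem z_mem_nonZeroDivisors : X.z ∈ nonZeroDivisors X.InftyRing := by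
  rw [mem_nonZeroDivisors_iff_right]
  intro t ht
  obtain ⟨a, b, rfl⟩ := DoubleCoverRing.exists_eq t
  have h := DoubleCoverRing.eq_zero (p := X.h) (a := a * Polynomial.X) (b := b * Polynomial.X) (by
    rw [map_mul, map_mul, Polynomial.aeval_X]
    rw [← ht, z]; ring)
  have ha : a = 0 := by simpa using h.1
  have hb : b = 0 := by simpa using h.2
  simp [ha, hb]

theorem resInfty_injective : Function.Injective X.resInfty :=
  IsLocalization.injective X.OverlapRing
    (Submonoid.powers_le.2 X.z_mem_nonZeroDivisors)

theorem resAffine_x : X.resAffine X.x = X.zInv := by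
  simp [resAffine, x, coordT, doubleCoverLift]

theorem resAffine_y : X.resAffine X.y = X.resInfty X.w * X.zInv ^ (g + 1) := by
  rw [resAffine, y, coordU, doubleCoverLift]
  exact AdjoinRoot.liftAlgHom_root _ _ _ _

/-- `z ^ N p(1 / z)` is the reflection of `p`. -/
theorem resInfty_z_pow_mul_resAffine_aeval (p : F[X]) {N : ℕ} (hN : p.natDegree ≤ N) :
    X.resInfty X.z ^ N * X.resAffine (Polynomial.aeval X.x p) =
      X.resInfty (Polynomial.aeval X.z (p.reflect N)) := by
  let i : Invertible X.zInv := ⟨X.resInfty X.z, X.resInfty_z_mul_zInv,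
    by rw [mul_comm]; exact X.resInfty_z_mul_zInv⟩
  have h1 := Polynomial.eval₂_reflect_mul_pow (algebraMap F X.OverlapRing) X.zInv N p hN
  have h2 : X.resInfty X.z ^ N * X.zInv ^ N = 1 := by
    rw [← mul_pow, X.resInfty_z_mul_zInv, one_pow]
  rw [← Polynomial.aeval_algHom_apply, ← Polynomial.aeval_algHom_apply, resAffine_x,
    Polynomial.aeval_def, Polynomial.aeval_def, ← h1]
  change _ = Polynomial.eval₂ _ (⅟X.zInv) _
  linear_combination (Polynomial.eval₂ (algebraMap F X.OverlapRing) (⅟X.zInv) (p.reflect N)) * h2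

/-- Reflection sends the coefficient of `p` at `i` to degree `k + N - i` on the right; for `i > m`
this lies below `k + N - m`, where the left side vanishes. -/
theorem natDegree_le_of_X_pow_mul_eq {p P : F[X]} {m k N : ℕ} (hN : p.natDegree ≤ N)
    (hmk : m ≤ k + N)
    (h : Polynomial.X ^ (k + N - m) * P = Polynomial.X ^ k * p.reflect N) :
    p.natDegree ≤ m := by
  rw [Polynomial.natDegree_le_iff_coeff_eq_zero]
  intro i hi
  by_cases hiN : i ≤ N
  · have hc := congrArg (fun q => q.coeff (k + (N - i))) h
    rw [Polynomial.coeff_X_pow_mul', if_neg (by omega), Polynomial.coeff_X_pow_mul', if_pos (by omega),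
      Nat.add_sub_cancel_left, Polynomial.coeff_reflect, Polynomial.revAt_le (by omega),
      Nat.sub_sub_self hiN] at hc
    exact hc.symm
  · exact Polynomial.coeff_eq_zero_of_natDegree_lt (by omega)

/-- The pole of a section of `𝒪(2ℓ ∞_X)` at `∞_X` has order at most `2ℓ`. -/
theorem exists_natDegree_le_of_mem_sections {ℓ : ℕ} (hgℓ : g < ℓ) {s : X.AffineRing × X.InftyRing}
    (hs : s ∈ X.sections ℓ) : ∃ p q : F[X], p.natDegree ≤ ℓ ∧ q.natDegree ≤ ℓ - g - 1 ∧
      s.1 = Polynomial.aeval X.x p + Polynomial.aeval X.x q * X.y := by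
  obtain ⟨p, q, hpq⟩ := DoubleCoverRing.exists_eq s.1
  obtain ⟨P, Q, hPQ⟩ := DoubleCoverRing.exists_eq s.2
  change s.1 = Polynomial.aeval X.x p + Polynomial.aeval X.x q * X.y at hpq
  change s.2 = Polynomial.aeval X.z P + Polynomial.aeval X.z Q * X.w at hPQ
  have hs' : X.resInfty s.2 = X.resInfty X.z ^ ℓ * X.resAffine s.1 := hs
  -- `K` bounds both degrees. The reflection of `p` uses `K + (g+1)` because `y = w / z^(g+1)`
  -- already carries `g + 1` factors of `1/z`.
  set K := max p.natDegree q.natDegree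
  have hp := X.resInfty_z_pow_mul_resAffine_aeval p (N := K + (g + 1))
    ((le_max_left _ _).trans (Nat.le_add_right _ _))
  have hq := X.resInfty_z_pow_mul_resAffine_aeval q (N := K) (le_max_right _ _)
  have hzz : X.resInfty X.z ^ (g + 1) * X.zInv ^ (g + 1) = 1 := by
    rw [← mul_pow, X.resInfty_z_mul_zInv, one_pow]
  have key : X.z ^ (K + (g + 1)) * s.2 = X.z ^ ℓ *
      (Polynomial.aeval X.z (p.reflect (K + (g + 1))) +
        Polynomial.aeval X.z (q.reflect K) * X.w) := by
    apply X.resInfty_injective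
    rw [map_mul, hs', hpq, map_mul, map_add X.resInfty, map_mul X.resInfty (Polynomial.aeval _ _),
      ← hp, ← hq, map_add X.resAffine, map_mul X.resAffine, resAffine_y, map_pow, map_pow]
    linear_combination (X.resInfty X.z ^ (K + ℓ) * X.resAffine (Polynomial.aeval X.x q) *
      X.resInfty X.w) * hzz
  rw [hPQ] at key
  have h := (DoubleCoverRing.ext_iff (p := X.h) (a := Polynomial.X ^ (K + (g + 1)) * P)
    (b := Polynomial.X ^ (K + (g + 1)) * Q)
    (a' := Polynomial.X ^ ℓ * p.reflect (K + (g + 1)))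
    (b' := Polynomial.X ^ ℓ * q.reflect K)).1 (by
      simp only [map_mul, map_pow, Polynomial.aeval_X]
      change X.z ^ _ * _ + X.z ^ _ * _ * X.w = X.z ^ _ * _ + X.z ^ _ * _ * X.w
      simp only [mul_assoc, ← mul_add]
      exact key)
  refine ⟨p, q, ?_, ?_, hpq⟩
  · refine natDegree_le_of_X_pow_mul_eq (N := K + (g + 1)) (k := ℓ) (P := P)
      ((le_max_left _ _).trans (Nat.le_add_right _ _)) (by omega) ?_
    rw [Nat.add_sub_cancel_left]
    exact h.1
  · refine natDegree_le_of_X_pow_mul_eq (N := K) (k := ℓ) (P := Q) (le_max_right _ _) (by omega) ?_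
    rw [show ℓ + K - (ℓ - g - 1) = K + (g + 1) by omega]
    exact h.2

theorem affineMonomial_inftyMonomial_mem_sections (ℓ : ℕ) (hgℓ : g < ℓ) {n : ℕ} (hn : n ≤ 2 * ℓ - g) :
    (X.affineMonomial ℓ n, X.inftyMonomial ℓ n) ∈ X.sections ℓ := by
  change X.resInfty (X.inftyMonomial ℓ n) = X.resInfty X.z ^ ℓ * X.resAffine (X.affineMonomial ℓ n)
  have hz : ∀ k m, m ≤ k →
      X.resInfty X.z ^ (k - m) = X.resInfty X.z ^ k * X.zInv ^ m := by
    intro k m hmk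
    obtain ⟨d, rfl⟩ := Nat.exists_eq_add_of_le' hmk
    rw [Nat.add_sub_cancel, pow_add, mul_assoc, ← mul_pow, X.resInfty_z_mul_zInv, one_pow, mul_one]
  unfold affineMonomial inftyMonomial
  split_ifs with h1 h2
  · rw [map_pow, map_pow, resAffine_x, hz _ _ (by omega)]
  · rw [map_mul, map_mul, map_pow, map_pow, resAffine_x, resAffine_y, Nat.sub_sub, Nat.sub_sub,
      hz _ _ (by omega), pow_add, pow_add, pow_add]
    ring
  · rw [map_pow, map_pow, resAffine_x, hz _ _ (by omega)]

theorem affineMonomial_two_mul_add_one {ℓ i : ℕ} (hi : i < ℓ - g) :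
    X.affineMonomial ℓ (2 * i + 1) = X.x ^ i * X.y := by
  rw [affineMonomial, if_pos (by omega), if_neg (by simp)]
  congr 2; omega

/-- The index of `x ^ i`. -/
def xIndex (ℓ g i : ℕ) : ℕ := if i < ℓ - g then 2 * i else i + (ℓ - g)

theorem affineMonomial_xIndex (ℓ i : ℕ) : X.affineMonomial ℓ (xIndex ℓ g i) = X.x ^ i := by
  unfold xIndex
  split_ifs with h
  · rw [affineMonomial, if_pos (by omega), if_pos (by simp), Nat.mul_div_cancel_left _ two_pos]
  · rw [affineMonomial, if_neg (by omega), Nat.add_sub_cancel]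

theorem aeval_mem_span_affineMonomial {ℓ : ℕ} (hgℓ : g < ℓ) {p q : F[X]} (hp : p.natDegree ≤ ℓ)
    (hq : q.natDegree ≤ ℓ - g - 1) :
    Polynomial.aeval X.x p + Polynomial.aeval X.x q * X.y ∈
      Submodule.span F (Set.range fun i : Fin (2 * ℓ - g + 1) => X.affineMonomial ℓ i) := by
  rw [Polynomial.aeval_eq_sum_range' (Nat.lt_succ_of_le hp),
    Polynomial.aeval_eq_sum_range' (Nat.lt_succ_of_le hq), Finset.sum_mul]
  refine Submodule.add_mem _ (Submodule.sum_mem _ fun i hi => Submodule.smul_mem _ _ ?_)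
    (Submodule.sum_mem _ fun i hi => ?_)
  · rw [Finset.mem_range] at hi
    refine Submodule.subset_span ⟨⟨xIndex ℓ g i, ?_⟩, X.affineMonomial_xIndex ℓ i⟩
    unfold xIndex; split_ifs <;> omega
  · rw [Finset.mem_range] at hi
    rw [smul_mul_assoc]
    exact Submodule.smul_mem _ _ (Submodule.subset_span ⟨⟨2 * i + 1, by omega⟩,
      X.affineMonomial_two_mul_add_one (by omega)⟩)

/-- The part of `affineMonomial` without `y`. -/
def affineEvenPart (F : Type*) [Field F] (ℓ g n : ℕ) : F[X] :=
  if n < 2 * (ℓ - g) then if Even n then Polynomial.X ^ (n / 2) else 0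
  else Polynomial.X ^ (n - (ℓ - g))

/-- The coefficient of `y` in `affineMonomial`. -/
def affineOddPart (F : Type*) [Field F] (ℓ g n : ℕ) : F[X] :=
  if n < 2 * (ℓ - g) then if Even n then 0 else Polynomial.X ^ (n / 2) else 0

theorem affineMonomial_eq (ℓ n : ℕ) : X.affineMonomial ℓ n =
    Polynomial.aeval X.x (affineEvenPart F ℓ g n) +
      Polynomial.aeval X.x (affineOddPart F ℓ g n) * X.y := by
  unfold affineMonomial affineEvenPart affineOddPart
  split_ifs <;> simp

theorem linearIndependent_affineMonomial (ℓ : ℕ) :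
    LinearIndependent F fun i : Fin (2 * ℓ - g + 1) => X.affineMonomial ℓ i := by
  rw [Fintype.linearIndependent_iff]
  intro c hc n
  have h := DoubleCoverRing.eq_zero (p := X.f)
    (a := ∑ i : Fin (2 * ℓ - g + 1), c i • affineEvenPart F ℓ g i)
    (b := ∑ i : Fin (2 * ℓ - g + 1), c i • affineOddPart F ℓ g i) (by
      change Polynomial.aeval X.x _ + Polynomial.aeval X.x _ * X.y = 0
      rw [← hc, map_sum, map_sum, Finset.sum_mul, ← Finset.sum_add_distrib]
      refine Finset.sum_congr rfl fun i _ => ?_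
      rw [affineMonomial_eq, map_smul, map_smul, smul_mul_assoc, smul_add])
  -- Each `x^i` and each `x^i y` occurs at most once in the sequence, so a single coefficient
  -- isolates `c n`.
  have hcoeff : ∀ (A : ℕ → F[X]) (d : ℕ), ∑ i : Fin (2 * ℓ - g + 1), c i • A i = 0 →
      (A n).coeff d = 1 → (∀ m : ℕ, m ≠ n → (A m).coeff d = 0) → c n = 0 := by
    intro A d hA h1 h0
    have hA' := congrArg (fun q => q.coeff d) hA
    simp only [Polynomial.finsetSum_coeff, Polynomial.coeff_smul, Polynomial.coeff_zero] at hA'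
    rw [Finset.sum_eq_single n (fun m _ hm => by
      rw [h0 m (fun h => hm (Fin.ext h)), smul_zero]) (by simp), h1, smul_eq_mul, mul_one] at hA'
    exact hA'
  by_cases hn : (n : ℕ) < 2 * (ℓ - g)
  · by_cases he : Even (n : ℕ)
    · refine hcoeff _ (n / 2) h.1 (by simp [affineEvenPart, hn, he]) fun m hm => ?_
      unfold affineEvenPart
      rw [Nat.even_iff] at he
      split_ifs with h1 h2
      · rw [Nat.even_iff] at h2
        rw [Polynomial.coeff_X_pow, if_neg (by omega)]
      · simp
      · rw [Polynomial.coeff_X_pow, if_neg (by omega)]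
    · refine hcoeff _ (n / 2) h.2 (by simp [affineOddPart, hn, he]) fun m hm => ?_
      unfold affineOddPart
      rw [Nat.even_iff] at he
      split_ifs with h1 h2
      · simp
      · rw [Nat.even_iff] at h2
        rw [Polynomial.coeff_X_pow, if_neg (by omega)]
      · simp
  · refine hcoeff _ (n - (ℓ - g)) h.1 (by simp [affineEvenPart, hn]) fun m hm => ?_
    unfold affineEvenPart
    split_ifs with h1 h2
    · rw [Polynomial.coeff_X_pow, if_neg (by omega)]
    · simp
    · rw [Polynomial.coeff_X_pow, if_neg (by omega)]

theorem exists_basis_sections (ℓ : ℕ) (hgℓ : g < ℓ) :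
    ∃ b : Module.Basis (Fin (2 * ℓ - g + 1)) F (X.sections ℓ), ∀ i,
      (b i : X.AffineRing × X.InftyRing) = (X.affineMonomial ℓ i, X.inftyMonomial ℓ i) := by
  let v : Fin (2 * ℓ - g + 1) → X.sections ℓ := fun i =>
    ⟨(X.affineMonomial ℓ i, X.inftyMonomial ℓ i),
      X.affineMonomial_inftyMonomial_mem_sections ℓ hgℓ (Nat.le_of_lt_succ i.2)⟩
  -- A section is determined by its function on the affine chart, so independence and spanning can
  -- be checked after applying `π`.
  let π : X.sections ℓ →ₗ[F] X.AffineRing := LinearMap.fst F _ _ ∘ₗ (X.sections ℓ).subtype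
  have hπ : Function.Injective π := by
    rw [injective_iff_map_eq_zero]
    rintro ⟨⟨s, t⟩, hst⟩ h0
    have hs : s = 0 := h0
    have hst' : X.resInfty t = X.resInfty X.z ^ ℓ * X.resAffine s := hst
    rw [hs, map_zero, mul_zero] at hst'
    have ht : t = 0 := X.resInfty_injective (by rw [hst', map_zero])
    ext <;> simp [hs, ht]
  have hli : LinearIndependent F v := 
    LinearIndependent.of_comp π (X.linearIndependent_affineMonomial ℓ)
  have hsp : ⊤ ≤ Submodule.span F (Set.range v) := by
    rintro s -
    obtain ⟨p, q, hp, hq, hpq⟩ := X.exists_natDegree_le_of_mem_sections hgℓ s.2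
    have hmem := X.aeval_mem_span_affineMonomial hgℓ hp hq
    rw [← hpq] at hmem
    have hr : (Set.range fun i : Fin (2 * ℓ - g + 1) => X.affineMonomial ℓ i) = π '' Set.range v := by
      rw [← Set.range_comp]; rfl
    rw [hr, Submodule.span_image] at hmem
    obtain ⟨s', hs', hs''⟩ := hmem
    rwa [hπ (show π s' = π s from hs'')] at hs'
  exact ⟨Module.Basis.mk hli hsp, fun i => by rw [Module.Basis.mk_apply]⟩

end HyperellipticCurve

end

theorem theorem3p13 {F : Type*} [Field F] (hF : (2 : F) ≠ 0) (g ℓ : ℕ) (hgℓ : g < ℓ)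
    (hℓ : ℓ % 4 = 1) (X : HyperellipticCurve F g) :
    ∃ b : Module.Basis (Fin (2 * ℓ - g + 1)) F (X.sections ℓ),
      (∀ i, (b i : X.AffineRing × X.InftyRing) =
        (X.affineMonomial ℓ (i : ℕ), X.inftyMonomial ℓ (i : ℕ))) ∧
      (((matrixM ℓ g).det : F) ≠ 0 →
        lowestOrderTerm
            (hasseWronskian fun i =>
              X.expansion (b i : X.AffineRing × X.InftyRing).2) =
          lowestOrderTerm
            ((-1) ^ (1 + (ℓ - g).choose 2) * PowerSeries.C ((matrixM ℓ g).det : F) *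
              hasseD 1 (X.expansion X.z) ^ (g + 1).choose 2 *
              hasseD 2 (X.expansion X.z) ^ (ℓ * (ℓ - g)))) := by
  obtain ⟨b, hb⟩ := X.exists_basis_sections ℓ hgℓ
  refine ⟨b, hb, fun hM => ?_⟩
  simp only [hb]
  exact X.lowestOrderTerm_hasseWronskian hF ℓ hgℓ hℓ hM
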